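/- Let $R$ be a commutative Noetherian ring with unity and let $k\in\mathbb N$ (with $0\in\mathbb N$). Order $\mathbb N^k$ componentwise, and let $R[\mathbb N^k]$ be the monoid ring, graded by $R[\mathbb N^k]_h=\{rX^h : r\in R\}$. A *graded $R[\mathbb N^k]$-module* is a direct sum $M=\bigoplus_{g\in\mathbb N^k}M_g$ of a family of abelian groups $(M_g)_{g\in\mathbb N^k}$, together with an $R[\mathbb N^k]$-module structure on the abelian group $M$ such that $R[\mathbb N^k]_h\cdot M_g\subseteq M_{h+g}$ for all $g,h$. Morphisms of graded modules are the $R[\mathbb N^k]$-linear maps $f:M\to N$ with $f(M_g)\subseteq N_g$ for all $g$. A graded module is finitely generated if it is finitely generated as an $R[\mathbb N^k]$-module. A *persistence module over $\mathbb N^k$* is a family of $R$-modules $(M_g)_{g\in\mathbb N^k}$ with $R$-linear maps $\varphi_{g_1,g_2}:M_{g_1}\to M_{g_2}$ for $g_1\le g_2$ such that $\varphi_{g,g}=\mathrm{id}$ and $\varphi_{g_1,g_3}=\varphi_{g_2,g_3}\circ\varphi_{g_1,g_2}$ for $g_1\le g_2\le g_3$. Morphisms of persistence modules are the families of $R$-linear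 maps $\xi_g:M_g\to N_g$ that commute with the maps $\varphi$ of the two persistence modules. An element $h\in\mathbb N^k$ is a *frame* of $g\in\mathbb N^k$ if $h\le g$ and $\varphi_{h,g'}$ is an isomorphism for all $g'$ with $h\le g'\le g$. A persistence module is of *finite type* if there is a finite set $H\subseteq\mathbb N^k$ such that every $g\in\mathbb N^k$ has a frame in $H$. It is of *finitely generated type* if, in addition, every $M_g$ is a finitely generated $R$-module. Then the category of finitely generated graded $R[\mathbb N^k]$-modules is isomorphic to the category of persistence modules over $\mathbb N^k$ of finitely generated type (both with all the morphisms above). That is, there are functors $F$ and $F'$ between these two categories, in opposite directions, such that $F'\circ F$ and $F\circ F'$ are equal to the identity functors. -/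

import Mathlib

open CategoryTheory DirectSum

universe u v

/-! ### Graded modules over the monoid ring `R[G]` -/

/-- A `G`-graded `R[G]`-module: a family of abelian groups `(M_g)_{g ∈ G}` together with an
`R[G]`-module structure on the abelian group `⨁ g, M_g` such that `R[G]_h • M_g ⊆ M_{h + g}`.
Here `R[G]_h` is the additive group of all `r X^h` (`AddMonoidAlgebra.grade R h`), and `M_g` is
viewed as the `g`-th summand of the direct sum. -/
structure GradedModuleOver (R : Type u) [CommRing R] (G : Type) [AddMonoid G] [DecidableEq G] where
  /-- The homogeneous components. -/
  component : G → Type v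
  [addCommGroup : ∀ g, AddCommGroup (component g)]
  [module : Module (AddMonoidAlgebra R G) (⨁ g, component g)]
  [gradedSMul : SetLike.GradedSMul (AddMonoidAlgebra.grade R : G → Submodule R (AddMonoidAlgebra R G))
    (fun g : G => (DirectSum.of component g).range)]

namespace GradedModuleOver

attribute [instance] addCommGroup module gradedSMul

variable {R : Type u} [CommRing R] {G : Type} [AddMonoid G] [DecidableEq G]

/-- The underlying `R[G]`-module `⨁ g, M_g`. -/
abbrev total (M : GradedModuleOver.{u, v} R G) : Type v := ⨁ g, M.component g

/-- The `g`-th homogeneous part `M_g`, as an additive subgroup of `⨁ g, M_g`. -/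
abbrev homogeneousPart (M : GradedModuleOver.{u, v} R G) (g : G) : AddSubgroup M.total :=
  (DirectSum.of M.component g).range

/-- Graded morphisms: `R[G]`-linear maps `f` with `f (M_g) ⊆ N_g` for all `g`. -/
@[ext]
structure Hom (M N : GradedModuleOver.{u, v} R G) where
  /-- The underlying `R[G]`-linear map. -/
  toLinearMap : M.total →ₗ[AddMonoidAlgebra R G] N.total
  map_mem : ∀ (g : G) (x : M.total), x ∈ M.homogeneousPart g → toLinearMap x ∈ N.homogeneousPart g

/-- The category of `G`-graded `R[G]`-modules and graded morphisms. -/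
noncomputable instance : Category.{v} (GradedModuleOver.{u, v} R G) where
  Hom := Hom
  id M := ⟨LinearMap.id, fun _ _ hx => hx⟩
  comp f f' := ⟨f'.toLinearMap.comp f.toLinearMap,
    fun g x hx => f'.map_mem g _ (f.map_mem g x hx)⟩

/-- Finite generation of a graded module, as an `R[G]`-module. -/
def isFinitelyGenerated (R : Type u) [CommRing R] (G : Type) [AddMonoid G] [DecidableEq G] :
    ObjectProperty (GradedModuleOver.{u, v} R G) :=
  fun M => Module.Finite (AddMonoidAlgebra R G) M.total

end GradedModuleOver

/-! ### Persistence modules over a poset -/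

/-- Persistence modules over `G` with coefficients in `R`: functors from the poset category `G` to
the category of `R`-modules, with natural transformations as morphisms. For `G = ℕ^k` with the
componentwise order, `g₁ ≤ g₂` if and only if `g₂ = h + g₁` for some `h`. -/
abbrev PersistenceModule (R : Type u) [CommRing R] (G : Type) [PartialOrder G] :=
  G ⥤ ModuleCat.{v} R

namespace PersistenceModule

variable {R : Type u} [CommRing R] {G : Type} [PartialOrder G]

/-- `h` is a frame of `g` with respect to `P` if `h ≤ g` and for all `h ≤ g' ≤ g` the map
`P_h → P_{g'}` is an isomorphism. -/
def IsFrame (P : PersistenceModule.{u, v} R G) (h g : G) : Prop :=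
  h ≤ g ∧ ∀ (g' : G) (hg' : h ≤ g'), g' ≤ g → IsIso (P.map (homOfLE hg'))

/-- `H` is a framing set of `P` if every `g` has a frame in `H`. -/
def IsFramingSet (P : PersistenceModule.{u, v} R G) (H : Set G) : Prop :=
  ∀ g : G, ∃ h ∈ H, P.IsFrame h g

/-- `P` is of finite type if it has a finite framing set. -/
def IsOfFiniteType (P : PersistenceModule.{u, v} R G) : Prop :=
  ∃ H : Set G, H.Finite ∧ P.IsFramingSet H

/-- `P` is of finitely generated type if it is of finite type and every `P_g` is a finitely
generated `R`-module. -/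
def isOfFinitelyGeneratedType (R : Type u) [CommRing R] (G : Type) [PartialOrder G] :
    ObjectProperty (PersistenceModule.{u, v} R G) :=
  fun P => P.IsOfFiniteType ∧ ∀ g : G, Module.Finite R (P.obj g)

end PersistenceModule

/-! ### Isomorphism of categories -/

/-- Two categories are isomorphic if there are functors in both directions whose composites are
equal (not only naturally isomorphic) to the identity functors. -/
def AreIsomorphicCategories (C : Type*) [Category* C] (D : Type*) [Category* D] : Prop :=
  ∃ (F : C ⥤ D) (F' : D ⥤ C), F ⋙ F' = 𝟭 C ∧ F' ⋙ F = 𝟭 D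

/-! A persistence module `P` becomes the graded module `⨁ g, P_g`, with `X^h` acting by the
structure maps `P_g → P_{h+g}`. Since `g ≤ g'` means `g' = h + g` for some `h`, commuting with
monomials is naturality, so this functor is fully faithful. It is bijective on objects on the nose:
both constructions keep the same family of abelian groups, so only actions have to be compared.

It remains to match the finiteness conditions. Generators of the components at a finite framing set
generate everything (`finite_total`). Conversely, if finitely many `z` generate, then `P_g` is
spanned by the degree-`g` parts of the `X^h z` with `h ≤ g` (`finite_obj`). For finite type, `X_i :
P_g → P_{g+e_i}` is surjective once `g_i` reaches the largest `i`-degree of the generators, and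
injective once `g_i` exceeds the `i`-degrees of generators of the kernel of `X_i`, finitely many by
Hilbert's basis theorem. With a common bound `B`, the truncation `g ⊓ (B, …, B)` is a frame of `g`.
-/

/-- A fully faithful functor that is bijective on objects and matches two object properties
restricts to an isomorphism between the corresponding full subcategories. -/
theorem areIsomorphicCategories_fullSubcategory {C D : Type*} [Category* C] [Category* D]
    (E : C ⥤ D) [E.Full] [E.Faithful] (T : D → C) (hTE : ∀ X, T (E.obj X) = X)
    (hET : ∀ Y, E.obj (T Y) = Y) (P : ObjectProperty C) (Q : ObjectProperty D)
    (hPQ : ∀ X, P X ↔ Q (E.obj X)) :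
    AreIsomorphicCategories Q.FullSubcategory P.FullSubcategory := by
  -- On morphisms the inverse is forced: transport along `hET`, then pull back through `E`.
  -- Faithfulness of `E` gives the functor laws.
  let T' : D ⥤ C :=
    { obj := T
      map := fun {X Y} f => E.preimage (eqToHom (hET X) ≫ f ≫ eqToHom (hET Y).symm)
      map_id := fun X => E.map_injective (by simp)
      map_comp := fun f g => E.map_injective (by simp) }
  have hT' : ∀ Y, Q Y → P (T'.obj Y) := fun Y hY => (hPQ _).2 (by rw [hET]; exact hY)
  refine ⟨P.lift (Q.ι ⋙ T') fun Y => hT' _ Y.2,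
    Q.lift (P.ι ⋙ E) fun X => (hPQ _).1 X.2, ?_, ?_⟩
  · have hobj : ∀ Y : Q.FullSubcategory,
        (P.lift (Q.ι ⋙ T') (fun Y => hT' _ Y.2) ⋙
          Q.lift (P.ι ⋙ E) (fun X => (hPQ _).1 X.2)).obj Y = Y :=
      fun Y => ObjectProperty.FullSubcategory.ext (hET Y.obj)
    refine CategoryTheory.Functor.ext hobj fun X Y f => Q.ι.map_injective ?_
    simp only [Functor.map_comp, eqToHom_map]
    exact E.map_preimage _
  · have hobj : ∀ X : P.FullSubcategory,
        (Q.lift (P.ι ⋙ E) (fun X => (hPQ _).1 X.2) ⋙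
          P.lift (Q.ι ⋙ T') (fun Y => hT' _ Y.2)).obj X = X :=
      fun X => ObjectProperty.FullSubcategory.ext (hTE X.obj)
    refine CategoryTheory.Functor.ext hobj fun X Y f => P.ι.map_injective (E.map_injective ?_)
    simp only [Functor.map_comp, eqToHom_map]
    exact E.map_preimage _

/-! ### From persistence modules to graded modules. -/

namespace PersistenceModule

variable {R : Type u} [CommRing R] {G : Type} [PartialOrder G]

theorem map_map (P : PersistenceModule.{u, v} R G) {g₁ g₂ g₃ : G} (h₁ : g₁ ≤ g₂) (h₂ : g₂ ≤ g₃)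
    (x : P.obj g₁) :
    P.map (homOfLE h₂) (P.map (homOfLE h₁) x) = P.map (homOfLE (h₁.trans h₂)) x := by
  rw [← homOfLE_comp h₁ h₂, P.map_comp]; rfl

theorem map_refl (P : PersistenceModule.{u, v} R G) {g : G} (h : g ≤ g) (x : P.obj g) :
    P.map (homOfLE h) x = x := by
  have : homOfLE h = 𝟙 g := rfl
  rw [this, P.map_id]; rfl

theorem app_map {P Q : PersistenceModule.{u, v} R G} (ξ : P ⟶ Q) {g g' : G} (h : g ≤ g')
    (x : P.obj g) :
    ξ.app g' (P.map (homOfLE h) x) = Q.map (homOfLE h) (ξ.app g x) :=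
  NatTrans.naturality_apply ξ (homOfLE h) x

variable [DecidableEq G]

/-- The direct sum of the components of a persistence module. -/
abbrev total (P : PersistenceModule.{u, v} R G) : Type v := ⨁ g, P.obj g

/-- Degrees such as `0 + g` and `g` are only propositionally equal; comparing inside the direct sum
avoids casts between components. -/
theorem of_map (P : PersistenceModule.{u, v} R G) {g g₁ g₂ : G} (h₁ : g ≤ g₁) (h₂ : g ≤ g₂)
    (e : g₁ = g₂) (x : P.obj g) :
    DirectSum.of (fun g => P.obj g) g₁ (P.map (homOfLE h₁) x) =
      DirectSum.of (fun g => P.obj g) g₂ (P.map (homOfLE h₂) x) := by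
  subst e; rfl

/-- The morphism of graded modules induced by a morphism of persistence modules. -/
noncomputable def toGradedModuleHom {P Q : PersistenceModule.{u, v} R G} (ξ : P ⟶ Q) :
    P.total →ₗ[R] Q.total :=
  DirectSum.lmap fun g => (ξ.app g).hom

theorem toGradedModuleHom_of {P Q : PersistenceModule.{u, v} R G} (ξ : P ⟶ Q) (g : G)
    (x : P.obj g) :
    toGradedModuleHom ξ (DirectSum.of (fun g => P.obj g) g x) =
      DirectSum.of (fun g => Q.obj g) g (ξ.app g x) :=
  DirectSum.lmap_lof _ _ _

variable [AddCommMonoid G] [CanonicallyOrderedAdd G]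

/-- The action of the monomial `X^h` on the direct sum of a persistence module. -/
noncomputable def shift (P : PersistenceModule.{u, v} R G) (h : G) : P.total →ₗ[R] P.total :=
  DirectSum.toModule R G _ fun g =>
    DirectSum.lof R G (fun g => P.obj g) (h + g) ∘ₗ (P.map (homOfLE le_add_self)).hom

theorem shift_of (P : PersistenceModule.{u, v} R G) (h g : G) (x : P.obj g) :
    P.shift h (DirectSum.of (fun g => P.obj g) g x) =
      DirectSum.of (fun g => P.obj g) (h + g) (P.map (homOfLE le_add_self) x) := by
  rw [shift, ← DirectSum.lof_eq_of R, DirectSum.toModule_lof]; rfl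

/-- The monomial action as a monoid homomorphism. -/
noncomputable def shiftHom (P : PersistenceModule.{u, v} R G) :
    Multiplicative G →* Module.End R P.total where
  toFun h := P.shift h.toAdd
  map_one' := by
    refine DirectSum.linearMap_ext R fun g => LinearMap.ext fun x => ?_
    simp only [LinearMap.comp_apply, DirectSum.lof_eq_of, shift_of]
    exact (P.of_map _ le_rfl (zero_add g) x).trans (congrArg _ (P.map_refl le_rfl x))
  map_mul' a b := by
    refine DirectSum.linearMap_ext R fun g => LinearMap.ext fun x => ?_
    simp only [LinearMap.comp_apply, DirectSum.lof_eq_of, shift_of, Module.End.mul_apply, map_map]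
    exact P.of_map _ _ (add_assoc _ _ _) x

/-- The `R[G]`-module structure on the direct sum of a persistence module. -/
noncomputable instance totalModule (P : PersistenceModule.{u, v} R G) :
    Module (AddMonoidAlgebra R G) P.total :=
  Module.compHom P.total (AddMonoidAlgebra.lift R (Module.End R P.total) G P.shiftHom).toRingHom

theorem single_smul (P : PersistenceModule.{u, v} R G) (h : G) (r : R) (y : P.total) :
    AddMonoidAlgebra.single h r • y = r • P.shift h y := by
  change AddMonoidAlgebra.lift R (Module.End R P.total) G P.shiftHom _ y = _
  rw [AddMonoidAlgebra.lift_single]; rfl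

theorem single_smul_of (P : PersistenceModule.{u, v} R G) (h g : G) (r : R) (x : P.obj g) :
    AddMonoidAlgebra.single h r • DirectSum.of (fun g => P.obj g) g x =
      DirectSum.of (fun g => P.obj g) (h + g) (P.map (homOfLE le_add_self) (r • x)) := by
  rw [single_smul, shift_of, map_smul, ← DirectSum.lof_eq_of R, ← map_smul, DirectSum.lof_eq_of]

theorem single_smul_of_eq (P : PersistenceModule.{u, v} R G) {h g g' : G} (e : h + g = g')
    (hg : g ≤ g') (r : R) (x : P.obj g) :
    AddMonoidAlgebra.single h r • DirectSum.of (fun g => P.obj g) g x =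
      DirectSum.of (fun g => P.obj g) g' (P.map (homOfLE hg) (r • x)) := by
  rw [single_smul_of]; exact P.of_map _ _ e _

/-- The graded module of a persistence module. -/
noncomputable def toGradedModule (P : PersistenceModule.{u, v} R G) :
    GradedModuleOver.{u, v} R G where
  component g := P.obj g
  module := P.totalModule
  gradedSMul := ⟨by
    rintro h g a _ ha ⟨x, rfl⟩
    obtain ⟨r, rfl⟩ := (AddMonoidAlgebra.mem_grade_iff' R h a).1 ha
    exact ⟨_, (P.single_smul_of h g r x).symm⟩⟩

omit [CanonicallyOrderedAdd G] in
theorem total_induction (P : PersistenceModule.{u, v} R G)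
    {p : AddMonoidAlgebra R G → P.total → Prop}
    (h0 : ∀ a, p a 0) (h0' : ∀ y, p 0 y)
    (ha : ∀ a y z, p a y → p a z → p a (y + z)) (ha' : ∀ a b y, p a y → p b y → p (a + b) y)
    (hs : ∀ h r g x, p (AddMonoidAlgebra.single h r) (DirectSum.of (fun g => P.obj g) g x))
    (a : AddMonoidAlgebra R G) (y : P.total) : p a y := by
  induction y using DirectSum.induction_on with
  | zero => exact h0 a
  | add y z hy hz => exact ha _ _ _ hy hz
  | of g x =>
    induction a using AddMonoidAlgebra.induction_linear with
    | zero => exact h0' _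
    | add a b ha hb => exact ha' _ _ _ ha hb
    | single h r => exact hs _ _ _ _

theorem toGradedModuleHom_smul {P Q : PersistenceModule.{u, v} R G} (ξ : P ⟶ Q)
    (a : AddMonoidAlgebra R G) (y : P.total) :
    toGradedModuleHom ξ (a • y) = a • toGradedModuleHom ξ y := by
  refine P.total_induction (p := fun a y => toGradedModuleHom ξ (a • y) = a • toGradedModuleHom ξ y)
    (by simp) (by simp) (fun a y z hy hz => by simp only [smul_add, map_add, hy, hz])
    (fun a b y ha hb => by simp only [add_smul, map_add, ha, hb]) (fun h r g x => ?_) a y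
  simp only [single_smul_of, toGradedModuleHom_of, app_map, map_smul]

variable (R G) in
/-- The functor from persistence modules to graded modules. -/
noncomputable def gradedModuleFunctor :
    PersistenceModule.{u, v} R G ⥤ GradedModuleOver.{u, v} R G where
  obj P := P.toGradedModule
  map {P Q} ξ :=
    { toLinearMap :=
        { toFun := toGradedModuleHom ξ
          map_add' := map_add _
          map_smul' := toGradedModuleHom_smul ξ }
      map_mem := by
        rintro g _ ⟨x, rfl⟩
        exact ⟨_, (toGradedModuleHom_of ξ g x).symm⟩ }
  map_id P := by
    refine GradedModuleOver.Hom.ext (LinearMap.ext fun y => ?_)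
    exact LinearMap.congr_fun (f := toGradedModuleHom (𝟙 P)) (g := LinearMap.id)
      (DirectSum.linearMap_ext R fun g => LinearMap.ext fun x => toGradedModuleHom_of _ _ _) y
  map_comp {P Q S} ξ η := by
    refine GradedModuleOver.Hom.ext (LinearMap.ext fun y => ?_)
    refine LinearMap.congr_fun (f := toGradedModuleHom (ξ ≫ η))
      (g := toGradedModuleHom η ∘ₗ toGradedModuleHom ξ)
      (DirectSum.linearMap_ext R fun g => LinearMap.ext fun x => ?_) y
    simp only [LinearMap.comp_apply, DirectSum.lof_eq_of, toGradedModuleHom_of]; rfl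

instance : (gradedModuleFunctor.{u, v} R G).Faithful where
  map_injective {P Q} ξ η e := by
    ext g x
    have h := LinearMap.congr_fun (congrArg GradedModuleOver.Hom.toLinearMap e)
      (DirectSum.of (fun g => P.obj g) g x)
    exact DirectSum.of_injective (β := fun g => Q.obj g) g
      ((toGradedModuleHom_of ξ g x).symm.trans (h.trans (toGradedModuleHom_of η g x)))

end PersistenceModule

/-! ### Fullness of the functor. -/

namespace PersistenceModule

variable {R : Type u} [CommRing R] {G : Type} [AddCommMonoid G] [PartialOrder G]
  [CanonicallyOrderedAdd G] [DecidableEq G]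

theorem exists_of_hom {P Q : PersistenceModule.{u, v} R G}
    (f : (gradedModuleFunctor.{u, v} R G).obj P ⟶ (gradedModuleFunctor.{u, v} R G).obj Q)
    (g : G) (x : P.obj g) :
    ∃ y : Q.obj g, f.toLinearMap (DirectSum.of (fun g => P.obj g) g x) =
      DirectSum.of (fun g => Q.obj g) g y := by
  obtain ⟨y, hy⟩ := f.map_mem g _ ⟨x, rfl⟩
  exact ⟨y, hy.symm⟩

/-- The components of a morphism of graded modules. -/
noncomputable def homComponent {P Q : PersistenceModule.{u, v} R G}
    (f : (gradedModuleFunctor.{u, v} R G).obj P ⟶ (gradedModuleFunctor.{u, v} R G).obj Q)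
    (g : G) (x : P.obj g) : Q.obj g :=
  (exists_of_hom f g x).choose

theorem of_homComponent {P Q : PersistenceModule.{u, v} R G}
    (f : (gradedModuleFunctor.{u, v} R G).obj P ⟶ (gradedModuleFunctor.{u, v} R G).obj Q)
    (g : G) (x : P.obj g) :
    DirectSum.of (fun g => Q.obj g) g (homComponent f g x) =
      f.toLinearMap (DirectSum.of (fun g => P.obj g) g x) :=
  (exists_of_hom f g x).choose_spec.symm

/-- This is linearity of `f` over `r X^h`, read in degree `g'`. The case `h = 0` yields
`R`-linearity of the components, the case `r = 1` naturality. -/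
theorem homComponent_map_smul {P Q : PersistenceModule.{u, v} R G}
    (f : (gradedModuleFunctor.{u, v} R G).obj P ⟶ (gradedModuleFunctor.{u, v} R G).obj Q)
    {h g g' : G} (e : h + g = g') (hg : g ≤ g') (r : R) (x : P.obj g) :
    homComponent f g' (P.map (homOfLE hg) (r • x)) =
      Q.map (homOfLE hg) (r • homComponent f g x) := by
  refine DirectSum.of_injective (β := fun g => Q.obj g) g' ?_
  rw [of_homComponent, ← P.single_smul_of_eq e, ← Q.single_smul_of_eq e, of_homComponent]
  exact f.toLinearMap.map_smul _ _

/-- The morphism of persistence modules given by the components of a morphism of graded modules. -/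
noncomputable def homPreimage {P Q : PersistenceModule.{u, v} R G}
    (f : (gradedModuleFunctor.{u, v} R G).obj P ⟶ (gradedModuleFunctor.{u, v} R G).obj Q) :
    P ⟶ Q where
  app g := ModuleCat.ofHom
    { toFun := homComponent f g
      map_add' := fun x y => by
        refine DirectSum.of_injective (β := fun g => Q.obj g) g ?_
        rw [map_add, of_homComponent, of_homComponent, of_homComponent, map_add]
        exact f.toLinearMap.map_add _ _
      map_smul' := fun r x => by
        have := homComponent_map_smul f (zero_add g) le_rfl r x
        rwa [map_refl, map_refl] at this }
  naturality g g' i := by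
    obtain ⟨h, rfl⟩ := exists_add_of_le i.le
    ext x
    have := homComponent_map_smul f (add_comm h g) i.le 1 x
    rwa [one_smul, one_smul] at this

instance : (gradedModuleFunctor.{u, v} R G).Full where
  map_surjective {P Q} f := by
    refine ⟨homPreimage f, GradedModuleOver.Hom.ext (LinearMap.toAddMonoidHom_injective ?_)⟩
    refine DirectSum.addHom_ext fun g x => ?_
    exact (toGradedModuleHom_of _ g x).trans (of_homComponent f g x)

end PersistenceModule

/-! ### From graded modules to persistence modules. -/

namespace GradedModuleOver

variable {R : Type u} [CommRing R] {G : Type} [AddCommMonoid G] [DecidableEq G]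

/-- The action of the monomial `r X^h`, followed by the projection to the degree `g'`, on the
component of degree `g`. -/
noncomputable def act (M : GradedModuleOver.{u, v} R G) (h : G) (r : R) (g g' : G) :
    M.component g →+ M.component g' :=
  ((DFinsupp.evalAddMonoidHom g').comp
    (DistribSMul.toAddMonoidHom M.total (AddMonoidAlgebra.single h r))).comp
      (DirectSum.of M.component g)

/-- Gradedness puts the product in the summand of degree `h + g`, so the projection in `act` loses
nothing. -/
theorem of_act (M : GradedModuleOver.{u, v} R G) {h g g' : G} (e : h + g = g') (r : R)
    (x : M.component g) :
    DirectSum.of M.component g' (M.act h r g g' x) =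
      AddMonoidAlgebra.single h r • DirectSum.of M.component g x := by
  subst e
  have hx : DirectSum.of M.component g x ∈ (DirectSum.of M.component g).range := ⟨x, rfl⟩
  obtain ⟨y, hy⟩ := M.gradedSMul.smul_mem (AddMonoidAlgebra.single_mem_grade h r) hx
  change DirectSum.of M.component _ ((AddMonoidAlgebra.single h r •
    DirectSum.of M.component g x) (h + g)) = _
  rw [← hy]
  exact congrArg _ (DirectSum.of_eq_same _ _)

theorem act_act (M : GradedModuleOver.{u, v} R G) {h h' k g g' g'' : G} (e : h + g = g')
    (e' : h' + g' = g'') (ek : k + g = g'') (hk : h' + h = k) (r r' : R) (x : M.component g) :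
    M.act h' r' g' g'' (M.act h r g g' x) = M.act k (r' * r) g g'' x := by
  refine DirectSum.of_injective g'' ?_
  rw [M.of_act e', M.of_act e, M.of_act ek, smul_smul, AddMonoidAlgebra.single_mul_single, hk]

theorem act_one (M : GradedModuleOver.{u, v} R G) (g : G) (x : M.component g) :
    M.act 0 1 g g x = x := by
  refine DirectSum.of_injective g ?_
  rw [M.of_act (zero_add g)]
  exact one_smul _ _

theorem act_add (M : GradedModuleOver.{u, v} R G) (h : G) (r r' : R) (g g' : G)
    (x : M.component g) : M.act h (r + r') g g' x = M.act h r g g' x + M.act h r' g g' x := by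
  change (AddMonoidAlgebra.single h (r + r') • DirectSum.of M.component g x) g' = _
  rw [AddMonoidAlgebra.single_add, add_smul]; rfl

theorem act_zero (M : GradedModuleOver.{u, v} R G) (h : G) (g g' : G)
    (x : M.component g) : M.act h (0 : R) g g' x = 0 := by
  have := M.act_add h 0 0 g g' x
  rw [add_zero] at this
  exact left_eq_add.1 this

/-- The `R`-module structure on the components of a graded module. -/
noncomputable abbrev componentModule (M : GradedModuleOver.{u, v} R G) (g : G) :
    Module R (M.component g) where
  smul r x := M.act 0 r g g x
  one_smul := M.act_one g
  mul_smul r s x :=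
    (M.act_act (zero_add g) (zero_add g) (zero_add g) (by rw [add_zero]) s r x).symm
  smul_zero r := map_zero _
  smul_add r := map_add _
  add_smul r s x := M.act_add 0 r s g g x
  zero_smul x := M.act_zero 0 g g x

/-- The components of a graded module, as objects of the category of `R`-modules. -/
noncomputable def componentModuleCat (M : GradedModuleOver.{u, v} R G) (g : G) :
    ModuleCat.{v} R :=
  letI := M.componentModule g
  ModuleCat.of R (M.component g)

variable [PartialOrder G] [CanonicallyOrderedAdd G] [Sub G] [OrderedSub G]
  [IsOrderedCancelAddMonoid G]

/-- The persistence module of a graded module. -/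
noncomputable def toPersistenceModule (M : GradedModuleOver.{u, v} R G) :
    PersistenceModule.{u, v} R G where
  obj g := M.componentModuleCat g
  map {g g'} i :=
    ModuleCat.ofHom (X := M.componentModuleCat g) (Y := M.componentModuleCat g')
      { toFun := M.act (g' - g) 1 g g'
        map_add' := map_add _
        map_smul' := fun r x =>
          (M.act_act (zero_add g) (tsub_add_cancel_of_le i.le) (tsub_add_cancel_of_le i.le)
            (by rw [add_zero]) r 1 x).trans
          ((congrArg (fun s => M.act (g' - g) s g g' x) (mul_comm 1 r)).trans
          (M.act_act (tsub_add_cancel_of_le i.le) (zero_add g') (tsub_add_cancel_of_le i.le)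
            (by rw [zero_add]) 1 r x).symm) }
  map_id g := ModuleCat.hom_ext <| LinearMap.ext fun x : M.component g =>
    (congrArg (fun h => M.act h 1 g g x) (tsub_self g)).trans (M.act_one g x)
  map_comp {g₁ g₂ g₃} i j := ModuleCat.hom_ext <| LinearMap.ext fun x : M.component g₁ =>
    (congrArg (fun r => M.act (g₃ - g₁) r g₁ g₃ x) (mul_one 1).symm).trans
      (M.act_act (tsub_add_cancel_of_le i.le) (tsub_add_cancel_of_le j.le)
        (tsub_add_cancel_of_le (i.le.trans j.le))
        (by rw [tsub_add_tsub_cancel j.le i.le]) 1 1 x).symm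

/-- The rebuilt action multiplies by `r X^0` and then by `X^((h + g) - g)`; cancellation turns the
product back into `r X^h`. -/
theorem single_smul_toPersistenceModule (M : GradedModuleOver.{u, v} R G) (h : G) (r : R) (g : G)
    (x : M.component g) :
    (AddMonoidAlgebra.single h r • DirectSum.of (fun g => M.toPersistenceModule.obj g) g x :
      M.toPersistenceModule.total) =
    (AddMonoidAlgebra.single h r • DirectSum.of M.component g x : M.total) := by
  refine (M.toPersistenceModule.single_smul_of h g r x).trans ?_
  refine Eq.trans (congrArg (DirectSum.of M.component (h + g)) ?_) (M.of_act (rfl : h + g = _) r x)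
  refine (M.act_act (zero_add g) (tsub_add_cancel_of_le le_add_self) rfl ?_ r 1 x).trans ?_
  · rw [add_zero, add_tsub_cancel_right]
  · rw [one_mul]

-- A module structure is a biadditive action, hence determined by monomials acting on homogeneous
-- elements; the grading condition is a proposition.
omit [PartialOrder G] [CanonicallyOrderedAdd G] [Sub G] [OrderedSub G]
  [IsOrderedCancelAddMonoid G] in
theorem mk_eq_mk {C : G → Type v} [∀ g, AddCommGroup (C g)]
    (m₁ m₂ : Module (AddMonoidAlgebra R G) (⨁ g, C g)) (h₁ h₂)
    (e : ∀ (h : G) (r : R) (g : G) (x : C g),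
      m₁.smul (AddMonoidAlgebra.single h r) (DirectSum.of C g x) =
        m₂.smul (AddMonoidAlgebra.single h r) (DirectSum.of C g x)) :
    @GradedModuleOver.mk R _ G _ _ C _ m₁ h₁ = @GradedModuleOver.mk R _ G _ _ C _ m₂ h₂ := by
  have key : (@Module.toAddMonoidEnd (AddMonoidAlgebra R G) (⨁ g, C g) _ _ m₁).toAddMonoidHom =
      (@Module.toAddMonoidEnd (AddMonoidAlgebra R G) (⨁ g, C g) _ _ m₂).toAddMonoidHom :=
    AddMonoidAlgebra.addMonoidHom_ext fun h r => DirectSum.addHom_ext fun g x => e h r g x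
  have : m₁ = m₂ :=
    Module.ext' _ _ fun a y => DFunLike.congr_fun (DFunLike.congr_fun key a) y
  subst this; rfl

theorem toGradedModule_toPersistenceModule (M : GradedModuleOver.{u, v} R G) :
    M.toPersistenceModule.toGradedModule = M :=
  mk_eq_mk _ _ _ _ M.single_smul_toPersistenceModule

end GradedModuleOver

/-! ### Recovering a persistence module exactly. -/

namespace PersistenceModule

variable {R : Type u} [CommRing R]

theorem of_module_congr {C : Type v} [AddCommGroup C] {m₁ m₂ : Module R C} (e : m₁ = m₂) :
    @ModuleCat.of R _ C _ m₁ = @ModuleCat.of R _ C _ m₂ := by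
  subst e; rfl

/-- Makes the transports in an equality of functors invisible on elements. -/
theorem eqToHom_of {C : Type v} [AddCommGroup C] {m₁ m₂ : Module R C} (e : m₁ = m₂)
    (h : @ModuleCat.of R _ C _ m₁ = @ModuleCat.of R _ C _ m₂) (x : C) :
    (eqToHom h).hom x = x := by
  subst e; rfl

variable {G : Type} [AddCommMonoid G] [PartialOrder G]
  [CanonicallyOrderedAdd G] [DecidableEq G] [Sub G] [OrderedSub G]
  [IsOrderedCancelAddMonoid G]

omit [Sub G] [OrderedSub G] [IsOrderedCancelAddMonoid G] in
theorem act_toGradedModule (P : PersistenceModule.{u, v} R G) {h g g' : G} (e : h + g = g')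
    (hg : g ≤ g') (r : R) (x : P.obj g) :
    P.toGradedModule.act h r g g' x = P.map (homOfLE hg) (r • x) := by
  refine DirectSum.of_injective (β := fun g => P.obj g) g' ?_
  exact (P.toGradedModule.of_act e r x).trans (P.single_smul_of_eq e hg r x)

omit [Sub G] [OrderedSub G] [IsOrderedCancelAddMonoid G] in
theorem componentModule_toGradedModule (P : PersistenceModule.{u, v} R G) (g : G) :
    P.toGradedModule.componentModule g = (P.obj g).isModule := by
  refine Module.ext' _ _ fun r x => ?_
  exact (P.act_toGradedModule (zero_add g) le_rfl r x).trans (P.map_refl _ _)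

theorem toPersistenceModule_toGradedModule (P : PersistenceModule.{u, v} R G) :
    P.toGradedModule.toPersistenceModule = P := by
  refine CategoryTheory.Functor.ext (fun g => of_module_congr (P.componentModule_toGradedModule g))
    fun g g' i => ?_
  ext x
  have h₁ := eqToHom_of (P.componentModule_toGradedModule g)
    (of_module_congr (P.componentModule_toGradedModule g)) x
  refine (P.act_toGradedModule (tsub_add_cancel_of_le i.le) i.le 1 x).trans ?_
  refine Eq.trans ?_ (eqToHom_of (P.componentModule_toGradedModule g').symm
    (of_module_congr (P.componentModule_toGradedModule g').symm) _).symm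
  exact congrArg (P.map i) ((one_smul R _).trans h₁.symm)

end PersistenceModule

/-! ### Monomial multiples and finite generation. -/

namespace PersistenceModule

section Shift

variable {R : Type u} [CommRing R] {G : Type} [AddCommMonoid G] [PartialOrder G]
  [CanonicallyOrderedAdd G] [DecidableEq G]

theorem shift_zero (P : PersistenceModule.{u, v} R G) (y : P.total) : P.shift 0 y = y :=
  LinearMap.congr_fun P.shiftHom.map_one y

theorem shift_add (P : PersistenceModule.{u, v} R G) (h h' : G) (y : P.total) :
    P.shift (h + h') y = P.shift h (P.shift h' y) :=
  LinearMap.congr_fun (P.shiftHom.map_mul (.ofAdd h) (.ofAdd h')) y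

theorem shift_apply_of_not_le (P : PersistenceModule.{u, v} R G) {h g : G} (hg : ¬ h ≤ g)
    (y : P.total) : (P.shift h y : P.total) g = 0 := by
  induction y using DirectSum.induction_on with
  | zero => rw [map_zero]; rfl
  | add y z hy hz => rw [map_add, DirectSum.add_apply, hy, hz, add_zero]
  | of g' x =>
    rw [shift_of]
    exact DirectSum.of_eq_of_ne _ _ _ fun e => hg (e ▸ le_self_add)

theorem shift_apply_add [IsCancelAdd G] (P : PersistenceModule.{u, v} R G) (h g : G)
    (y : P.total) :
    (P.shift h y : P.total) (h + g) = P.map (homOfLE le_add_self) (y g) := by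
  induction y using DirectSum.induction_on with
  | zero => rw [map_zero]; exact (map_zero (P.map (homOfLE le_add_self)).hom).symm
  | add y z hy hz =>
    rw [map_add, DirectSum.add_apply, hy, hz, DirectSum.add_apply, map_add]
  | of g' x =>
    rw [shift_of]
    by_cases e : g' = g
    · subst e
      rw [DirectSum.of_eq_same, DirectSum.of_eq_same]
    · rw [DirectSum.of_eq_of_ne _ _ _ fun e' => e (add_left_cancel e').symm,
        DirectSum.of_eq_of_ne _ _ _ (Ne.symm e), map_zero]

/-- An `R`-submodule containing all monomial multiples of the generators contains their
`R[G]`-span. -/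
theorem mem_of_mem_span (P : PersistenceModule.{u, v} R G) {S : Set P.total}
    (N : Submodule R P.total) (hN : ∀ z ∈ S, ∀ h : G, P.shift h z ∈ N) {y : P.total}
    (hy : y ∈ Submodule.span (AddMonoidAlgebra R G) S) : y ∈ N := by
  -- `N` is only an `R`-submodule, so the scalar step of the induction needs the claim for all
  -- shifts of `y`.
  suffices ∀ h, P.shift h y ∈ N by simpa only [shift_zero] using this 0
  induction hy using Submodule.span_induction with
  | mem z hz => exact hN z hz
  | zero => intro h; rw [map_zero]; exact N.zero_mem
  | add y z _ _ hy hz => intro h; rw [map_add]; exact N.add_mem (hy h) (hz h)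
  | smul a y _ hy =>
    induction a using AddMonoidAlgebra.induction_linear with
    | zero => intro h; rw [zero_smul, map_zero]; exact N.zero_mem
    | add a b ha hb => intro h; rw [add_smul, map_add]; exact N.add_mem (ha h) (hb h)
    | single h' r =>
      intro h
      rw [single_smul, map_smul, ← shift_add]
      exact N.smul_mem _ (hy _)

theorem exists_finset_of_mem_span (P : PersistenceModule.{u, v} R G) (g : G)
    [Module.Finite R (P.obj g)] :
    ∃ S : Finset P.total, ∀ x : P.obj g,
      DirectSum.of (fun g => P.obj g) g x ∈
        Submodule.span (AddMonoidAlgebra R G) (S : Set P.total) := by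
  classical
  obtain ⟨T, hT⟩ := (Module.Finite.fg_top : (⊤ : Submodule R (P.obj g)).FG)
  refine ⟨T.image (DirectSum.of (fun g => P.obj g) g), fun x => ?_⟩
  have hx : x ∈ Submodule.span R (T : Set (P.obj g)) := hT ▸ Submodule.mem_top
  induction hx using Submodule.span_induction with
  | mem x hx => exact Submodule.subset_span (Finset.mem_coe.2 (Finset.mem_image_of_mem _ hx))
  | zero => rw [map_zero]; exact Submodule.zero_mem _
  | add x y _ _ hx hy => rw [map_add]; exact Submodule.add_mem _ hx hy
  | smul r x _ hx =>
    have := P.single_smul_of_eq (zero_add g) le_rfl r x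
    rw [map_refl] at this
    rw [← this]
    exact Submodule.smul_mem _ _ hx

/-- A persistence module of finite type with finitely generated components has a finitely generated
total module. -/
theorem finite_total (P : PersistenceModule.{u, v} R G) (hP : P.IsOfFiniteType)
    (hfin : ∀ g, Module.Finite R (P.obj g)) : Module.Finite (AddMonoidAlgebra R G) P.total := by
  classical
  obtain ⟨H, hH, hframe⟩ := hP
  choose S hS using fun g => P.exists_finset_of_mem_span g
  refine Module.finite_def.2 ⟨hH.toFinset.biUnion S, eq_top_iff.2 fun y _ => ?_⟩
  induction y using DirectSum.induction_on with
  | zero => exact Submodule.zero_mem _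
  | add y z hy hz => exact Submodule.add_mem _ (hy trivial) (hz trivial)
  | of g x =>
    obtain ⟨h, hhH, hg, hiso⟩ := hframe g
    have := hiso g hg le_rfl
    -- Surjectivity from the frame writes `x` as a monomial multiple of an element of `P_h`.
    obtain ⟨x', rfl⟩ := ((ConcreteCategory.isIso_iff_bijective (P.map (homOfLE hg))).1 this).2 x
    obtain ⟨d, rfl⟩ := exists_add_of_le hg
    have e := P.single_smul_of_eq (add_comm d h) hg 1 x'
    rw [one_smul] at e
    rw [← e]
    refine Submodule.smul_mem _ _ (Submodule.span_mono ?_ (hS h x'))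
    exact Finset.coe_subset.2 (Finset.subset_biUnion_of_mem S (hH.mem_toFinset.2 hhH))

end Shift

/-! ### Finite type over `ℕ^k`. -/

section Pi

variable {R : Type u} [CommRing R] {k : ℕ}

/-- `ℕ^k` is regarded as a poset category, not as a product of categories. -/
local instance piNatCategory : SmallCategory (Fin k → ℕ) := Preorder.smallCategory _

theorem finite_obj (P : PersistenceModule.{u, v} R (Fin k → ℕ))
    [Module.Finite (AddMonoidAlgebra R (Fin k → ℕ)) P.total] (g : Fin k → ℕ) :
    Module.Finite R (P.obj g) := by
  obtain ⟨S, hS⟩ := (Module.Finite.fg_top :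
    (⊤ : Submodule (AddMonoidAlgebra R (Fin k → ℕ)) P.total).FG)
  let T : Set (P.obj g) :=
    (fun p : (Fin k → ℕ) × P.total => (P.shift p.1 p.2 : P.total) g) ''
      (Set.Iic g ×ˢ (S : Set P.total))
  have hT : T.Finite := ((Set.finite_Iic g).prod S.finite_toSet).image _
  refine Module.finite_def.2 (Submodule.fg_def.2 ⟨T, hT, eq_top_iff.2 fun x _ => ?_⟩)
  have hx : DirectSum.of (fun g => P.obj g) g x ∈
      (Submodule.span R T).comap (DirectSum.component R _ (fun g => P.obj g) g) := by
    refine P.mem_of_mem_span (S := S) _ (fun z hz h => ?_) (hS ▸ Submodule.mem_top)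
    change (P.shift h z : P.total) g ∈ Submodule.span R T
    by_cases hg : h ≤ g
    · exact Submodule.subset_span ⟨(h, z), ⟨hg, hz⟩, rfl⟩
    · rw [shift_apply_of_not_le _ hg]; exact Submodule.zero_mem _
  have hx' : (DirectSum.of (fun g => P.obj g) g x : P.total) g ∈ Submodule.span R T := hx
  rwa [DirectSum.of_eq_same] at hx'

theorem exists_bound (P : PersistenceModule.{u, v} R (Fin k → ℕ)) (S : Finset P.total)
    (i : Fin k) : ∃ N : ℕ, ∀ z ∈ S, ∀ g : Fin k → ℕ, N < g i → z g = 0 := by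
  classical
  refine ⟨S.sup fun z => (DFinsupp.support z).sup fun g => g i, fun z hz g hg => ?_⟩
  by_contra hne
  have h₁ : g i ≤ (DFinsupp.support z).sup fun g => g i :=
    Finset.le_sup (f := fun g : Fin k → ℕ => g i) (DFinsupp.mem_support_iff.2 hne)
  have h₂ := Finset.le_sup (f := fun z : P.total => (DFinsupp.support z).sup fun g => g i) hz
  exact absurd hg (not_lt.2 (h₁.trans h₂))

theorem shift_apply_eq_zero (P : PersistenceModule.{u, v} R (Fin k → ℕ)) {z : P.total} {i : Fin k}
    {N : ℕ} (hz : ∀ g : Fin k → ℕ, N < g i → z g = 0) {h : Fin k → ℕ} (hi : h i = 0)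
    {g : Fin k → ℕ} (hg : N < g i) : (P.shift h z : P.total) g = 0 := by
  by_cases hle : h ≤ g
  · obtain ⟨d, rfl⟩ := exists_add_of_le hle
    rw [shift_apply_add, hz d (by simpa [hi] using hg), map_zero]
  · exact P.shift_apply_of_not_le hle z

theorem single_le_of_ne_zero {h : Fin k → ℕ} {i : Fin k} (hi : h i ≠ 0) :
    Pi.single i 1 ≤ h := by
  intro j
  by_cases e : j = i
  · subst e; simpa using Nat.one_le_iff_ne_zero.2 hi
  · simp [e]

/-- Take finitely many generators `z` of the kernel of `X_i`. A multiple `X^h z` vanishes if `X_i`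
divides `X^h`; otherwise its `i`-degrees stay bounded by those of `z`. So the kernel has nothing in
large `i`-degree. -/
theorem exists_forall_injective (P : PersistenceModule.{u, v} R (Fin k → ℕ))
    [IsNoetherian (AddMonoidAlgebra R (Fin k → ℕ)) P.total] (i : Fin k) :
    ∃ N : ℕ, ∀ g : Fin k → ℕ, N ≤ g i →
      Function.Injective (P.map (homOfLE (le_add_self : g ≤ Pi.single i 1 + g))) := by
  let K : Submodule (AddMonoidAlgebra R (Fin k → ℕ)) P.total :=
    LinearMap.ker (LinearMap.lsmul (AddMonoidAlgebra R (Fin k → ℕ)) P.total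
      (AddMonoidAlgebra.single (Pi.single i 1) 1))
  have hK (y : P.total) : y ∈ K ↔ P.shift (Pi.single i 1) y = 0 := by
    rw [LinearMap.mem_ker, LinearMap.lsmul_apply, single_smul, one_smul]
  obtain ⟨S, hS⟩ := IsNoetherian.noetherian K
  obtain ⟨N, hN⟩ := P.exists_bound S i
  -- `N + 1`, as generators may live in `i`-degree exactly `N`.
  refine ⟨N + 1, fun g hg => (injective_iff_map_eq_zero _).2 fun x hx => ?_⟩
  have hxK : DirectSum.of (fun g => P.obj g) g x ∈ K := by
    rw [hK, shift_of, hx, map_zero]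
  let L : Submodule R P.total := LinearMap.ker (DirectSum.component R _ (fun g => P.obj g) g)
  have hxL : DirectSum.of (fun g => P.obj g) g x ∈ L := by
    refine P.mem_of_mem_span (S := S) _ (fun z hz h => ?_) (hS ▸ hxK)
    change (P.shift h z : P.total) g = 0
    by_cases hi : h i = 0
    · exact P.shift_apply_eq_zero (hN z hz) hi hg
    · obtain ⟨d, rfl⟩ := exists_add_of_le (single_le_of_ne_zero hi)
      have hzK : z ∈ K := hS ▸ Submodule.subset_span hz
      rw [add_comm, shift_add, (hK z).1 hzK, map_zero]; rfl
  have hxL' : (DirectSum.of (fun g => P.obj g) g x : P.total) g = 0 := hxL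
  rwa [DirectSum.of_eq_same] at hxL'

/-- In degree `e_i + g`, multiples `X^h z` of generators with `h i = 0` vanish, and all others are
divisible by `X_i`. Here `N` suffices because the target has `i`-degree above `N`. -/
theorem exists_forall_surjective (P : PersistenceModule.{u, v} R (Fin k → ℕ))
    [Module.Finite (AddMonoidAlgebra R (Fin k → ℕ)) P.total] (i : Fin k) :
    ∃ N : ℕ, ∀ g : Fin k → ℕ, N ≤ g i →
      Function.Surjective (P.map (homOfLE (le_add_self : g ≤ Pi.single i 1 + g))) := by
  obtain ⟨S, hS⟩ := (Module.Finite.fg_top :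
    (⊤ : Submodule (AddMonoidAlgebra R (Fin k → ℕ)) P.total).FG)
  obtain ⟨N, hN⟩ := P.exists_bound S i
  refine ⟨N, fun g hg x => ?_⟩
  let L : Submodule R P.total :=
    (LinearMap.range (P.map (homOfLE (le_add_self : g ≤ Pi.single i 1 + g))).hom).comap
      (DirectSum.component R _ (fun g => P.obj g) (Pi.single i 1 + g))
  have hxL : DirectSum.of (fun g => P.obj g) _ x ∈ L := by
    refine P.mem_of_mem_span (S := S) _ (fun z hz h => ?_) (hS ▸ Submodule.mem_top)
    change (P.shift h z : P.total) (Pi.single i 1 + g) ∈ LinearMap.range _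
    by_cases hi : h i = 0
    · rw [P.shift_apply_eq_zero (hN z hz) hi (by simp; omega)]
      exact Submodule.zero_mem _
    · obtain ⟨d, rfl⟩ := exists_add_of_le (single_le_of_ne_zero hi)
      rw [shift_add, shift_apply_add]
      exact ⟨_, rfl⟩
  obtain ⟨w, hw⟩ := hxL
  exact ⟨w, hw.trans (DirectSum.of_eq_same _ _)⟩

/-- Climb from `h` to `g` by unit steps, moving only in directions where `h` is already at least
`N`. -/
theorem isIso_map_of_le (P : PersistenceModule.{u, v} R (Fin k → ℕ)) {N : ℕ}
    (hN : ∀ (i : Fin k) (g : Fin k → ℕ), N ≤ g i →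
      IsIso (P.map (homOfLE (le_add_self : g ≤ Pi.single i 1 + g))))
    {h g : Fin k → ℕ} (hg : h ≤ g) (hlt : ∀ i, h i < g i → N ≤ h i) :
    IsIso (P.map (homOfLE hg)) := by
  obtain ⟨d, rfl⟩ := exists_add_of_le hg
  induction n : ∑ i, d i generalizing h d with
  | zero =>
    have hd : d = 0 :=
      funext fun i => by simpa using (Finset.sum_eq_zero_iff.1 n) i (Finset.mem_univ i)
    subst hd
    have : homOfLE hg = 𝟙 h := rfl
    rw [this]
    infer_instance
  | succ n' ih =>
    obtain ⟨i, -, hi⟩ := Finset.exists_ne_zero_of_sum_ne_zero (n.trans_ne n'.succ_ne_zero)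
    obtain ⟨d, rfl⟩ := exists_add_of_le (single_le_of_ne_zero hi)
    have hstep : h ≤ Pi.single i 1 + h := le_add_self
    have hcomm : h + (Pi.single i 1 + d) = Pi.single i 1 + h + d := by
      rw [← add_assoc, add_comm h]
    rw [hcomm] at hlt
    revert hg
    rw [hcomm]
    intro hg
    have hle : Pi.single i 1 + h ≤ Pi.single i 1 + h + d := le_self_add
    have h₁ := hN i h (hlt i (by simp; omega))
    have h₂ : IsIso (P.map (homOfLE hle)) := by
      -- Coordinates only grow along the climb, so the bound is inherited.
      refine ih d hle (fun j hj => (hlt j ((hstep j).trans_lt hj)).trans (hstep j)) ?_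
      simp [Finset.sum_add_distrib] at n
      omega
    rw [← homOfLE_comp hstep hle, P.map_comp]
    infer_instance

theorem isOfFiniteType (P : PersistenceModule.{u, v} R (Fin k → ℕ)) [IsNoetherianRing R]
    [Module.Finite (AddMonoidAlgebra R (Fin k → ℕ)) P.total] : P.IsOfFiniteType := by
  have : IsNoetherianRing (AddMonoidAlgebra R (Fin k → ℕ)) :=
    Algebra.FiniteType.isNoetherianRing R _
  choose N hN using P.exists_forall_injective
  choose N' hN' using P.exists_forall_surjective
  let B := Finset.univ.sup N ⊔ Finset.univ.sup N'
  refine ⟨Set.Iic fun _ => B, Set.finite_Iic _, fun g => ⟨g ⊓ fun _ => B,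
    Set.mem_Iic.2 inf_le_right, inf_le_left,
    fun g' hg' hle => P.isIso_map_of_le (N := B) (fun i g hg => ?_) hg' fun i hi => ?_⟩⟩
  · refine (ConcreteCategory.isIso_iff_bijective _).2 ⟨hN i g ?_, hN' i g ?_⟩
    · exact ((Finset.le_sup (Finset.mem_univ i)).trans le_sup_left).trans hg
    · exact ((Finset.le_sup (Finset.mem_univ i)).trans le_sup_right).trans hg
  -- If `min (g i) B` lies strictly below `g' i ≤ g i`, it must equal `B`.
  · have hi'' : g' i ≤ g i := hle i
    have hi' : min (g i) B < g' i := hi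
    change B ≤ min (g i) B
    omega

theorem isOfFinitelyGeneratedType_iff [IsNoetherianRing R]
    (P : PersistenceModule.{u, v} R (Fin k → ℕ)) :
    isOfFinitelyGeneratedType.{u, v} R (Fin k → ℕ) P ↔
      GradedModuleOver.isFinitelyGenerated.{u, v} R (Fin k → ℕ)
        ((gradedModuleFunctor.{u, v} R (Fin k → ℕ)).obj P) :=
  ⟨fun h => P.finite_total h.1 h.2, fun h =>
    have : Module.Finite (AddMonoidAlgebra R (Fin k → ℕ)) P.total := h
    ⟨P.isOfFiniteType, P.finite_obj⟩⟩

end Pi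

end PersistenceModule

theorem mainTheorem4 (R : Type u) [CommRing R] [IsNoetherianRing R] (k : ℕ) :
    AreIsomorphicCategories
      (GradedModuleOver.isFinitelyGenerated.{u, v} R (Fin k → ℕ)).FullSubcategory
      (PersistenceModule.isOfFinitelyGeneratedType.{u, v} R (Fin k → ℕ)).FullSubcategory :=
  areIsomorphicCategories_fullSubcategory (PersistenceModule.gradedModuleFunctor R (Fin k → ℕ))
    GradedModuleOver.toPersistenceModule
    PersistenceModule.toPersistenceModule_toGradedModule
    GradedModuleOver.toGradedModule_toPersistenceModule _ _
    PersistenceModule.isOfFinitelyGeneratedType_iff
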